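/- Let $n,m\ge 0$ be integers and let $R,\varepsilon$ be real numbers with $0<\varepsilon<2R$. Let $B_R=\{x\in\mathbb{R}^n:\|x\|\le R\}$ be the closed Euclidean ball of radius $R$. (1) Let $H_1,\dots,H_m$ be any affine (not necessarily linear) hyperplanes in $\mathbb{R}^n$, and call the connected components of $B_R\setminus(H_1\cup\dots\cup H_m)$ the cells into which they divide $B_R$. If $$m<\frac{2}{e}\,\frac{R}{\varepsilon}\,n,$$ then there are two points $x,y$ of $B_R$ in the same cell with $\|x-y\|\ge\varepsilon$. (2) Consequently, uniform $\varepsilon$-localization on $B_R$ from $m$ paired comparisons requires $m\ge\frac{2}{e}\frac{R}{\varepsilon}n$. That is, let $p_1,q_1,\dots,p_m,q_m\in\mathbb{R}^n$ and $\mathcal{A}_i(x)=\operatorname{sign}\left(\|x-q_i\|^2-\|x-p_i\|^2\right)\in\{-1,0,1\}$. If any two points $x,y\in B_R$ with $\mathcal{A}_i(x)=\mathcal{A}_i(y)$ for all $i$ satisfy $\|x-y\|\le\varepsilon$, then $m\ge\frac{2}{e}\frac{R}{\varepsilon}n$. -/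

import Mathlib

open Metric

/-- `H` is an (inhomogeneous) affine hyperplane of `ℝⁿ`. -/
def IsAffineHyperplane {n : ℕ} (H : Set (EuclideanSpace ℝ (Fin n))) : Prop :=
  ∃ (a : EuclideanSpace ℝ (Fin n)) (τ : ℝ), a ≠ 0 ∧ H = {x | inner ℝ a x = τ}

/-- The part of the closed ball `B_R` (centre `0`) that lies on none of the sets `H i`. -/
def ballComplement {n m : ℕ} (R : ℝ) (H : Fin m → Set (EuclideanSpace ℝ (Fin n))) :
    Set (EuclideanSpace ℝ (Fin n)) :=
  closedBall 0 R \ ⋃ i, H i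

/-- The cells into which the sets `H i` divide `B_R`: the connected components of
`B_R` minus the union of the `H i`. -/
def IsCell {n m : ℕ} (R : ℝ) (H : Fin m → Set (EuclideanSpace ℝ (Fin n)))
    (C : Set (EuclideanSpace ℝ (Fin n))) : Prop :=
  ∃ x ∈ ballComplement R H, C = connectedComponentIn (ballComplement R H) x

/-- The noise-free comparison of `p` with `q` at the point `x`: it is `1` if `x` is closer to `p`,
`-1` if `x` is closer to `q`, and `0` for a tie. -/
noncomputable def comparison {n : ℕ} (p q x : EuclideanSpace ℝ (Fin n)) : SignType :=
  SignType.sign (‖x - q‖ ^ 2 - ‖x - p‖ ^ 2)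

/-- The comparisons of the pairs `(p i, q i)` localize the points of `B_R` uniformly to within `ε`:
points of `B_R` with the same outcomes are at distance at most `ε`. -/
def UniformlyLocalizes {n m : ℕ} (R ε : ℝ) (p q : Fin m → EuclideanSpace ℝ (Fin n)) : Prop :=
  ∀ x ∈ closedBall (0 : EuclideanSpace ℝ (Fin n)) R,
    ∀ y ∈ closedBall (0 : EuclideanSpace ℝ (Fin n)) R,
      (∀ i, comparison (p i) (q i) x = comparison (p i) (q i) y) → ‖x - y‖ ≤ ε

/-! Suppose every piece cut from `B_R` has diameter at most `ε`. By the isodiametric inequality each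
has at most the volume of a ball of radius `ε/2`, and hyperplanes are null, so there are at least
`(2R/ε)^n` pieces. Conversely, affine functions on `ℝⁿ` shatter at most `n` indices, so Sauer–Shelah
allows at most `∑_{k≤n} C(m,k)` sign patterns, which is at most `(em/n)^n` when `0 < n ≤ m`. Taking
`n`-th roots gives `m ≥ (2/e)(R/ε)n`. If `m < n`, some direction is orthogonal to all normals, and a
segment of length `ε` in that direction avoids every hyperplane.

The isodiametric inequality is Prékopa–Leindler applied to the indicators of `A` and `-A`. Part (2)
applies part (1) to the bisectors of the pairs, with `ε` slightly enlarged. -/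

open MeasureTheory ENNReal

/-! ### Brunn–Minkowski and Prékopa–Leindler on the line -/

/-- One-dimensional Brunn–Minkowski inequality for compact sets. -/
theorem volume_add_le_of_isCompact {K L C : Set ℝ} (hK : IsCompact K) (hL : IsCompact L)
    (hK0 : K.Nonempty) (hL0 : L.Nonempty) (h : ∀ x ∈ K, ∀ y ∈ L, x + y ∈ C) :
    volume K + volume L ≤ volume C := by
  obtain ⟨a, haK, ha⟩ := hK.exists_isGreatest hK0
  obtain ⟨b, hbL, hb⟩ := hL.exists_isLeast hL0
  -- The translates `K + b` and `L + a` both lie in `K + L` and meet at most in `a + b`.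
  set K' := (fun x => x + -b) ⁻¹' K with hK'
  set L' := (fun x => x + -a) ⁻¹' L with hL'
  have h1 : volume K' = volume K := measure_preimage_add_right _ _ _
  have h2 : volume L' = volume L := measure_preimage_add_right _ _ _
  have hL'm : MeasurableSet L' := hL.measurableSet.preimage (by fun_prop)
  have hdisj : AEDisjoint volume K' L' := by
    refine measure_mono_null (t := {a + b}) ?_ (by simp)
    rintro x ⟨hx, hx'⟩
    have h1 := ha hx
    have h2 := hb hx'
    simp only [Set.mem_singleton_iff]
    linarith
  rw [← h1, ← h2, ← measure_union₀ hL'm.nullMeasurableSet hdisj]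
  refine measure_mono ?_
  rintro x (hx | hx)
  · simpa using h _ hx _ hbL
  · simpa using h _ haK _ hx

/-- One-dimensional Brunn–Minkowski inequality. -/
theorem volume_add_le {A B C : Set ℝ} (hA : MeasurableSet A) (hB : MeasurableSet B)
    (hA0 : A.Nonempty) (hB0 : B.Nonempty) (h : ∀ x ∈ A, ∀ y ∈ B, x + y ∈ C) :
    volume A + volume B ≤ volume C := by
  obtain ⟨a, ha⟩ := hA0
  obtain ⟨b, hb⟩ := hB0
  rw [hA.measure_eq_iSup_isCompact, hB.measure_eq_iSup_isCompact]
  simp only [iSup_and']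
  refine ENNReal.biSup_add_biSup_le' ⟨∅, by simp⟩ ⟨∅, by simp⟩ ?_
  rintro K ⟨hKA, hK⟩ L ⟨hLB, hL⟩
  -- The approximating compact sets may be empty, where the inequality can fail; adding `a` and `b`
  -- prevents this.
  refine le_trans (add_le_add (measure_mono (Set.subset_insert a K))
    (measure_mono (Set.subset_insert b L))) ?_
  refine volume_add_le_of_isCompact (hK.insert a) (hL.insert b) (by simp) (by simp) ?_
  intro x hx y hy
  exact h x (Set.insert_subset ha hKA hx) y (Set.insert_subset hb hLB hy)

theorem volume_add_le_two_mul_midpoint {A B C : Set ℝ} (hA : MeasurableSet A)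
    (hB : MeasurableSet B) (hA0 : A.Nonempty) (hB0 : B.Nonempty)
    (h : ∀ x ∈ A, ∀ y ∈ B, (2 : ℝ)⁻¹ • (x + y) ∈ C) :
    volume A + volume B ≤ 2 * volume C := by
  have h1 := volume_add_le (C := ((2 : ℝ)⁻¹ • ·) ⁻¹' C) hA hB hA0 hB0 h
  rwa [Measure.addHaar_preimage_smul _ (by norm_num), Module.finrank_self, pow_one, inv_inv,
    abs_two, ENNReal.ofReal_ofNat] at h1

/-- Layer-cake formula, with Brunn–Minkowski at each height. `hfg` makes the two superlevel sets
empty simultaneously, since Brunn–Minkowski needs both nonempty. -/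
theorem lintegral_add_le_of_levels {f g h : ℝ → ℝ} (hf : Measurable f) (hg : Measurable g)
    (hh : Measurable h) (hf0 : 0 ≤ f) (hg0 : 0 ≤ g) (hh0 : 0 ≤ h)
    (hfg : ∀ t, (∃ x, t < f x) ↔ ∃ y, t < g y)
    (H : ∀ t, 0 < t → ∀ x y, t < f x → t < g y → t < h ((2 : ℝ)⁻¹ • (x + y))) :
    (∫⁻ x, ENNReal.ofReal (f x)) + (∫⁻ x, ENNReal.ofReal (g x)) ≤
      2 * ∫⁻ x, ENNReal.ofReal (h x) := by
  have anti : ∀ u : ℝ → ℝ, Measurable fun t => volume {a : ℝ | t < u a} := fun u =>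
    Antitone.measurable fun s t hst => measure_mono fun x (hx : t < u x) => hst.trans_lt hx
  rw [lintegral_eq_lintegral_meas_lt _ (ae_of_all _ hf0) hf.aemeasurable,
    lintegral_eq_lintegral_meas_lt _ (ae_of_all _ hg0) hg.aemeasurable,
    lintegral_eq_lintegral_meas_lt _ (ae_of_all _ hh0) hh.aemeasurable,
    ← lintegral_add_left (anti f), ← lintegral_const_mul _ (anti h)]
  refine setLIntegral_mono' measurableSet_Ioi fun t ht => ?_
  by_cases hx : ∃ x, t < f x
  · exact volume_add_le_two_mul_midpoint (measurableSet_lt measurable_const hf)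
      (measurableSet_lt measurable_const hg) hx ((hfg t).1 hx) fun x hx y hy => H t ht x y hx hy
  · have hy : ¬ ∃ y, t < g y := fun hy => hx ((hfg t).2 hy)
    have e1 : {x | t < f x} = ∅ := by
      simpa [Set.eq_empty_iff_forall_notMem] using hx
    have e2 : {x | t < g x} = ∅ := by
      simpa [Set.eq_empty_iff_forall_notMem] using hy
    simp [e1, e2]

theorem ENNReal.mul_le_sq_of_add_le_two_mul {p q r : ℝ≥0∞} (h : p + q ≤ 2 * r) :
    p * q ≤ r ^ 2 := by
  rcases eq_or_ne r ∞ with rfl | hr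
  · simp
  have hpq : p + q ≠ ∞ := ne_top_of_le_ne_top (by finiteness) h
  obtain ⟨hp, hq⟩ := ENNReal.add_ne_top.1 hpq
  lift p to NNReal using hp
  lift q to NNReal using hq
  lift r to NNReal using hr
  norm_cast at h ⊢
  have h' : (p : ℝ) + q ≤ 2 * r := by exact_mod_cast h
  have : (p : ℝ) * q ≤ r ^ 2 := by
    nlinarith [sq_nonneg ((p : ℝ) - q), p.2, q.2, mul_self_le_mul_self (add_nonneg p.2 q.2) h']
  exact_mod_cast this

theorem prekopaLeindler_real_of_bounded {f g h : ℝ → ℝ} (hf : Measurable f) (hg : Measurable g)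
    (hh : Measurable h) (hf0 : 0 ≤ f) (hg0 : 0 ≤ g) (hh0 : 0 ≤ h)
    (hfb : BddAbove (Set.range f)) (hgb : BddAbove (Set.range g))
    (H : ∀ x y, f x * g y ≤ h ((2 : ℝ)⁻¹ • (x + y)) ^ 2) :
    (∫⁻ x, ENNReal.ofReal (f x)) * ∫⁻ x, ENNReal.ofReal (g x) ≤
      (∫⁻ x, ENNReal.ofReal (h x)) ^ 2 := by
  by_cases hf1 : ∀ x, f x = 0
  · simp [hf1]
  by_cases hg1 : ∀ x, g x = 0
  · simp [hg1]
  push Not at hf1 hg1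
  obtain ⟨x₀, hx₀⟩ := hf1
  obtain ⟨y₀, hy₀⟩ := hg1
  set a := ⨆ x, f x with ha
  set b := ⨆ x, g x with hb
  have ha0 : 0 < a := ((hf0 x₀).lt_of_ne' hx₀).trans_le (le_ciSup hfb x₀)
  have hb0 : 0 < b := ((hg0 y₀).lt_of_ne' hy₀).trans_le (le_ciSup hgb y₀)
  -- This scaling gives `s * f` and `s⁻¹ * g` the same supremum `√(ab)` and leaves the product of
  -- the integrals unchanged; AM–GM then turns the sum into a product.
  set s := √(b / a) with hs
  have hs0 : 0 < s := Real.sqrt_pos.2 (by positivity)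
  have hs2 : s ^ 2 = b / a := Real.sq_sqrt (by positivity)
  have key := lintegral_add_le_of_levels (f := fun x => s * f x) (g := fun x => s⁻¹ * g x) (h := h)
    (hf.const_mul s) (hg.const_mul _) hh (fun x => mul_nonneg hs0.le (hf0 x))
    (fun x => mul_nonneg (inv_pos.2 hs0).le (hg0 x)) hh0 ?_ ?_
  · simp only [ENNReal.ofReal_mul hs0.le, ENNReal.ofReal_mul (inv_pos.2 hs0).le] at key
    rw [lintegral_const_mul _ (by fun_prop), lintegral_const_mul _ (by fun_prop)] at key
    have := ENNReal.mul_le_sq_of_add_le_two_mul key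
    have e : ENNReal.ofReal s * ENNReal.ofReal s⁻¹ = 1 := by
      rw [← ENNReal.ofReal_mul hs0.le, mul_inv_cancel₀ hs0.ne', ENNReal.ofReal_one]
    rwa [mul_mul_mul_comm, e, one_mul] at this
  · intro t
    have e1 : (∃ x, t < s * f x) ↔ t / s < a := by
      rw [ha, lt_ciSup_iff hfb]
      exact exists_congr fun x => by rw [div_lt_iff₀' hs0]
    have e2 : (∃ x, t < s⁻¹ * g x) ↔ t * s < b := by
      rw [hb, lt_ciSup_iff hgb]
      exact exists_congr fun x => by rw [lt_inv_mul_iff₀' hs0]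
    have e3 : b = a * s * s := by rw [mul_assoc, ← sq, hs2]; field_simp
    rw [e1, e2, e3, div_lt_iff₀ hs0, mul_lt_mul_iff_left₀ hs0]
  · intro t ht x y hx hy
    refine lt_of_pow_lt_pow_left₀ 2 (hh0 _) (lt_of_lt_of_le ?_ (H x y))
    calc t ^ 2 = t * t := sq t
      _ < (s * f x) * (s⁻¹ * g y) := mul_lt_mul'' hx hy ht.le ht.le
      _ = f x * g y := by field_simp

/-! ### Prékopa–Leindler from the line to Euclidean space -/

/-- The Prékopa–Leindler inequality (for midpoints) on the space `E`. -/
def PrekopaLeindler (E : Type*) [AddCommGroup E] [Module ℝ E] [MeasureSpace E] : Prop :=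
  ∀ f g h : E → ℝ≥0∞, Measurable f → Measurable g → Measurable h →
    (∀ x y, f x * g y ≤ h ((2 : ℝ)⁻¹ • (x + y)) ^ 2) →
      (∫⁻ x, f x) * ∫⁻ x, g x ≤ (∫⁻ x, h x) ^ 2

theorem lintegral_eq_iSup_min {α : Type*} [MeasurableSpace α] (μ : Measure α) {f : α → ℝ≥0∞}
    (hf : Measurable f) : ∫⁻ x, f x ∂μ = ⨆ k : ℕ, ∫⁻ x, min (f x) k ∂μ := by
  rw [← lintegral_iSup (fun k => hf.min measurable_const)]
  · refine lintegral_congr fun x => ?_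
    rw [← inf_iSup_eq, ENNReal.iSup_natCast, inf_top_eq]
  · intro k l hkl x
    exact min_le_min_left _ (by exact_mod_cast hkl)

theorem prekopaLeindler_real : PrekopaLeindler ℝ := by
  intro f g h hf hg hh H
  -- Truncating all three functions at `k` preserves the hypothesis and gives bounded functions;
  -- monotone convergence removes the cut.
  have trunc : ∀ k : ℕ, (∫⁻ x, min (f x) k) * (∫⁻ x, min (g x) k) ≤ (∫⁻ x, h x) ^ 2 := by
    intro k
    have fin : ∀ u : ℝ≥0∞, min u (k : ℝ≥0∞) ≠ ∞ := fun u =>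
      ne_top_of_le_ne_top (ENNReal.natCast_ne_top k) (min_le_right _ _)
    have bdd : ∀ u : ℝ → ℝ≥0∞, BddAbove (Set.range fun x => (min (u x) (k : ℝ≥0∞)).toReal) := by
      rintro u
      refine ⟨k, ?_⟩
      rintro _ ⟨x, rfl⟩
      exact ENNReal.toReal_le_of_le_ofReal (by positivity) (by simp)
    have key := prekopaLeindler_real_of_bounded (f := fun x => (min (f x) (k : ℝ≥0∞)).toReal)
      (g := fun x => (min (g x) (k : ℝ≥0∞)).toReal) (h := fun x => (min (h x) (k : ℝ≥0∞)).toReal)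
      (hf.min measurable_const).ennreal_toReal (hg.min measurable_const).ennreal_toReal
      (hh.min measurable_const).ennreal_toReal (fun x => ENNReal.toReal_nonneg)
      (fun x => ENNReal.toReal_nonneg) (fun x => ENNReal.toReal_nonneg) (bdd f) (bdd g) ?_
    · simp only [ENNReal.ofReal_toReal (fin _)] at key
      exact key.trans (by gcongr; exact min_le_left _ _)
    · intro x y
      rw [← ENNReal.toReal_mul, ← ENNReal.toReal_pow]
      refine ENNReal.toReal_mono (ENNReal.pow_ne_top (fin _)) ?_
      rcases min_choice (h ((2 : ℝ)⁻¹ • (x + y))) (k : ℝ≥0∞) with e | e <;> rw [e]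
      · exact (mul_le_mul' (min_le_left _ _) (min_le_left _ _)).trans (H x y)
      · rw [sq]; exact mul_le_mul' (min_le_right _ _) (min_le_right _ _)
  rw [lintegral_eq_iSup_min _ hf, lintegral_eq_iSup_min _ hg]
  rw [ENNReal.iSup_mul]
  refine iSup_le fun i => ?_
  rw [ENNReal.mul_iSup]
  refine iSup_le fun j => le_trans ?_ (trunc (max i j))
  gcongr <;> simp

/-- Tonelli: the inequality on `F`, applied to slices, is exactly the hypothesis on `E` for the
partial integrals. -/
theorem PrekopaLeindler.prod {E F : Type*} [AddCommGroup E] [Module ℝ E] [MeasureSpace E]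
    [AddCommGroup F] [Module ℝ F] [MeasureSpace F] [SFinite (volume : Measure E)]
    [SFinite (volume : Measure F)] (hE : PrekopaLeindler E) (hF : PrekopaLeindler F) :
    PrekopaLeindler (E × F) := by
  intro f g h hf hg hh H
  simp only [Measure.volume_eq_prod]
  rw [lintegral_prod _ hf.aemeasurable, lintegral_prod _ hg.aemeasurable,
    lintegral_prod _ hh.aemeasurable]
  refine hE _ _ _ hf.lintegral_prod_right' hg.lintegral_prod_right' hh.lintegral_prod_right' ?_
  intro x y
  exact hF _ _ _ (hf.comp measurable_prodMk_left) (hg.comp measurable_prodMk_left)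
    (hh.comp measurable_prodMk_left) fun u v => H (x, u) (y, v)

theorem PrekopaLeindler.of_measurePreserving {E F : Type*} [AddCommGroup E] [Module ℝ E]
    [MeasureSpace E] [AddCommGroup F] [Module ℝ F] [MeasureSpace F] (hE : PrekopaLeindler E)
    (φ : E → F) (hφ : MeasurePreserving φ)
    (hlin : ∀ x y, φ ((2 : ℝ)⁻¹ • (x + y)) = (2 : ℝ)⁻¹ • (φ x + φ y)) : PrekopaLeindler F := by
  intro f g h hf hg hh H
  rw [← hφ.lintegral_comp hf, ← hφ.lintegral_comp hg, ← hφ.lintegral_comp hh]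
  refine hE _ _ _ (hf.comp hφ.measurable) (hg.comp hφ.measurable) (hh.comp hφ.measurable) ?_
  intro x y
  rw [hlin]
  exact H _ _

theorem prekopaLeindler_pi (n : ℕ) : PrekopaLeindler (Fin n → ℝ) := by
  induction n with
  | zero =>
    intro f g h hf hg hh H
    simp only [Measure.volume_pi_eq_dirac (0 : Fin 0 → ℝ), lintegral_dirac' _ hf, lintegral_dirac' _ hg,
      lintegral_dirac' _ hh]
    simpa using H 0 0
  | succ n ih =>
    refine (prekopaLeindler_real.prod ih).of_measurePreserving
      (MeasurableEquiv.piFinSuccAbove (fun _ => ℝ) 0).symm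
      (volume_preserving_piFinSuccAbove (fun _ => ℝ) 0).symm ?_
    intro x y
    ext i
    refine Fin.cases ?_ (fun i => ?_) i <;> simp [MeasurableEquiv.piFinSuccAbove, mul_add]

theorem prekopaLeindler_euclideanSpace (n : ℕ) : PrekopaLeindler (EuclideanSpace ℝ (Fin n)) :=
  (prekopaLeindler_pi n).of_measurePreserving _ (PiLp.volume_preserving_toLp (Fin n))
    fun _ _ => rfl

/-! ### Isodiametric inequality -/

/-- The isodiametric inequality. -/
theorem volume_le_volume_closedBall_of_dist_le {n : ℕ} {A : Set (EuclideanSpace ℝ (Fin n))}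
    (hA : MeasurableSet A) {ε : ℝ} (h : ∀ x ∈ A, ∀ y ∈ A, ‖x - y‖ ≤ ε) :
    volume A ≤ volume (closedBall (0 : EuclideanSpace ℝ (Fin n)) (ε / 2)) := by
  -- A midpoint of `A` and `-A` is half a difference of two points of `A`, hence of norm at most `ε
  -- / 2`. As `-A` has the volume of `A`, the result is an inequality between squares.
  have key := prekopaLeindler_euclideanSpace n (A.indicator 1) ((-A).indicator 1)
    ((closedBall 0 (ε / 2)).indicator 1) (measurable_one.indicator hA)
    (measurable_one.indicator hA.neg) (measurable_one.indicator measurableSet_closedBall) ?_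
  · rw [lintegral_indicator_one hA, lintegral_indicator_one hA.neg,
      lintegral_indicator_one measurableSet_closedBall, Measure.measure_neg, ← sq] at key
    exact (ENNReal.pow_le_pow_left_iff two_ne_zero).1 key
  · intro x y
    by_cases hx : x ∈ A
    · by_cases hy : -y ∈ A
      · have : (2 : ℝ)⁻¹ • (x + y) ∈ closedBall (0 : EuclideanSpace ℝ (Fin n)) (ε / 2) := by
          have := h x hx (-y) hy
          rw [sub_neg_eq_add] at this
          rw [mem_closedBall_zero_iff, norm_smul, norm_inv, Real.norm_ofNat]
          linarith
        rw [Set.indicator_of_mem this]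
        simp [hx, hy]
      · simp [Set.indicator, hy]
    · simp [Set.indicator, hx]

/-! ### Counting sign patterns -/

/-- The open region cut out by the hyperplanes `⟪a i, x⟫ = τ i` that lies on the positive side
of those with index in `P` and on the negative side of the others. -/
def openRegion {n m : ℕ} (a : Fin m → EuclideanSpace ℝ (Fin n)) (τ : Fin m → ℝ)
    (P : Finset (Fin m)) : Set (EuclideanSpace ℝ (Fin n)) :=
  {x | ∀ i, (i ∈ P → τ i < inner ℝ (a i) x) ∧ (i ∉ P → inner ℝ (a i) x < τ i)}

theorem convex_openRegion {n m : ℕ} (a : Fin m → EuclideanSpace ℝ (Fin n)) (τ : Fin m → ℝ)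
    (P : Finset (Fin m)) : Convex ℝ (openRegion a τ P) := by
  have e : openRegion a τ P = ⋂ i, if i ∈ P then {x | τ i < innerₛₗ ℝ (a i) x}
      else {x | innerₛₗ ℝ (a i) x < τ i} := by
    ext x
    simp only [openRegion, Set.mem_ofPred_eq, Set.mem_iInter]
    refine forall_congr' fun i => ?_
    by_cases hi : i ∈ P <;> simp [hi]
  rw [e]
  refine convex_iInter fun i => ?_
  split_ifs
  · exact convex_halfSpace_gt (innerₛₗ ℝ (a i)).isLinear _
  · exact convex_halfSpace_lt (innerₛₗ ℝ (a i)).isLinear _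

theorem isOpen_openRegion {n m : ℕ} (a : Fin m → EuclideanSpace ℝ (Fin n)) (τ : Fin m → ℝ)
    (P : Finset (Fin m)) : IsOpen (openRegion a τ P) := by
  have e : openRegion a τ P = ⋂ i, if i ∈ P then {x | τ i < inner ℝ (a i) x}
      else {x | inner ℝ (a i) x < τ i} := by
    ext x
    simp only [openRegion, Set.mem_ofPred_eq, Set.mem_iInter]
    refine forall_congr' fun i => ?_
    by_cases hi : i ∈ P <;> simp [hi]
  rw [e]
  refine isOpen_iInter_of_finite fun i => ?_
  split_ifs
  · exact isOpen_lt (by fun_prop) (by fun_prop)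
  · exact isOpen_lt (by fun_prop) (by fun_prop)

theorem exists_mem_openRegion {n m : ℕ} (a : Fin m → EuclideanSpace ℝ (Fin n)) (τ : Fin m → ℝ)
    {x : EuclideanSpace ℝ (Fin n)} (hx : ∀ i, inner ℝ (a i) x ≠ τ i) :
    ∃ P, x ∈ openRegion a τ P := by
  classical
  refine ⟨Finset.univ.filter fun i => τ i < inner ℝ (a i) x, fun i => ⟨by simp, fun hi => ?_⟩⟩
  simp only [Finset.mem_filter, Finset.mem_univ, true_and, not_lt] at hi
  exact lt_of_le_of_ne hi (hx i)

theorem inner_ne_of_mem_openRegion {n m : ℕ} {a : Fin m → EuclideanSpace ℝ (Fin n)}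
    {τ : Fin m → ℝ} {P : Finset (Fin m)} {x : EuclideanSpace ℝ (Fin n)}
    (hx : x ∈ openRegion a τ P) (i : Fin m) : inner ℝ (a i) x ≠ τ i := by
  by_cases hi : i ∈ P
  · exact ((hx i).1 hi).ne'
  · exact ((hx i).2 hi).ne

open Classical in
/-- The sign patterns realised by an arrangement of hyperplanes. -/
noncomputable def signPatterns {n m : ℕ} (a : Fin m → EuclideanSpace ℝ (Fin n))
    (τ : Fin m → ℝ) : Finset (Finset (Fin m)) :=
  {P | (openRegion a τ P).Nonempty}

/-- More than `n` normals satisfy a linear relation with coefficients `g`, so the `g`-weighted sum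
of the affine functions is constant. Shattering would realise both the signs of `g` and their
opposites, making that constant positive and negative. -/
theorem card_le_of_shatters_signPatterns {n m : ℕ} {a : Fin m → EuclideanSpace ℝ (Fin n)}
    {τ : Fin m → ℝ} {S : Finset (Fin m)} (hS : (signPatterns a τ).Shatters S) : S.card ≤ n := by
  by_contra! hlt
  have hdep : ¬ LinearIndepOn ℝ a (S : Set (Fin m)) := by
    intro hli
    have := LinearIndependent.fintype_card_le_finrank hli
    simp at this
    omega
  obtain ⟨g, hg, i₀, hi₀, hgi₀⟩ := not_linearIndepOn_finset_iff.1 hdep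
  have sum_eq : ∀ x, ∑ i ∈ S, g i * (inner ℝ (a i) x - τ i) = - ∑ i ∈ S, g i * τ i := by
    intro x
    have h0 : ∑ i ∈ S, g i * inner ℝ (a i) x = 0 := by
      have := congrArg (fun v => inner ℝ v x) hg
      simpa [sum_inner, inner_smul_left] using this
    simp [mul_sub, Finset.sum_sub_distrib, h0]
  have real : ∀ T ⊆ S, ∃ x, ∀ i ∈ S, (i ∈ T → 0 < inner ℝ (a i) x - τ i) ∧
      (i ∉ T → inner ℝ (a i) x - τ i < 0) := by
    intro T hT
    obtain ⟨u, hu, rfl⟩ := hS hT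
    obtain ⟨x, hx⟩ : (openRegion a τ u).Nonempty := by simpa [signPatterns] using hu
    refine ⟨x, fun i hi => ⟨fun h => ?_, fun h => ?_⟩⟩
    · have := (hx i).1 (Finset.mem_inter.1 h).2
      linarith
    · have := (hx i).2 fun h' => h (Finset.mem_inter.2 ⟨hi, h'⟩)
      linarith
  obtain ⟨x, hx⟩ := real {i ∈ S | 0 < g i} (Finset.filter_subset _ _)
  obtain ⟨y, hy⟩ := real {i ∈ S | g i < 0} (Finset.filter_subset _ _)
  have posx : ∀ i ∈ S, g i ≠ 0 → 0 < g i * (inner ℝ (a i) x - τ i) := by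
    intro i hi hne
    rcases hne.lt_or_gt with h | h
    · exact mul_pos_of_neg_of_neg h ((hx i hi).2 (by simp [h.le]))
    · exact mul_pos h ((hx i hi).1 (by simp [hi, h]))
  have negy : ∀ i ∈ S, g i ≠ 0 → g i * (inner ℝ (a i) y - τ i) < 0 := by
    intro i hi hne
    rcases hne.lt_or_gt with h | h
    · exact mul_neg_of_neg_of_pos h ((hy i hi).1 (by simp [hi, h]))
    · exact mul_neg_of_pos_of_neg h ((hy i hi).2 (by simp [h.le]))
  have h1 : 0 < ∑ i ∈ S, g i * (inner ℝ (a i) x - τ i) := by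
    refine Finset.sum_pos' (fun i hi => ?_) ⟨i₀, hi₀, posx i₀ hi₀ hgi₀⟩
    by_cases h : g i = 0
    · simp [h]
    · exact (posx i hi h).le
  have h2 : ∑ i ∈ S, g i * (inner ℝ (a i) y - τ i) < 0 := by
    refine Finset.sum_neg' (fun i hi => ?_) ⟨i₀, hi₀, negy i₀ hi₀ hgi₀⟩
    by_cases h : g i = 0
    · simp [h]
    · exact (negy i hi h).le
  rw [sum_eq] at h1 h2
  linarith

/-- Sauer–Shelah for a family of VC dimension at most `n`. -/
theorem card_signPatterns_le {n m : ℕ} (a : Fin m → EuclideanSpace ℝ (Fin n)) (τ : Fin m → ℝ) :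
    (signPatterns a τ).card ≤ ∑ k ∈ Finset.range (n + 1), m.choose k := by
  have h1 : (signPatterns a τ).vcDim ≤ n :=
    Finset.sup_le fun S hS => card_le_of_shatters_signPatterns (Finset.mem_shatterer.1 hS)
  refine (Finset.card_le_card_shatterer _).trans (Finset.card_shatterer_le_sum_vcDim.trans ?_)
  rw [Fintype.card_fin]
  refine Finset.sum_le_sum_of_subset fun k hk => ?_
  simp only [Finset.mem_Iic, Finset.mem_range] at hk ⊢
  omega

/-- With `r = n/m ≤ 1`, one has `r^n ≤ r^k` for `k ≤ n`; the binomial theorem and `1 + r ≤ e^r` then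
bound `r^n` times the sum by `e^(rm) = e^n`. -/
theorem sum_choose_le_pow {n m : ℕ} (hn : 0 < n) (hnm : n ≤ m) :
    (∑ k ∈ Finset.range (n + 1), (m.choose k : ℝ)) ≤ (Real.exp 1 * m / n) ^ n := by
  have hn' : (0 : ℝ) < n := by exact_mod_cast hn
  have hm' : (0 : ℝ) < m := by exact_mod_cast hn.trans_le hnm
  set r : ℝ := n / m with hr
  have hr0 : 0 < r := by positivity
  have hr1 : r ≤ 1 := (div_le_one hm').2 (by exact_mod_cast hnm)
  have key : r ^ n * ∑ k ∈ Finset.range (n + 1), (m.choose k : ℝ) ≤ Real.exp 1 ^ n := by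
    calc r ^ n * ∑ k ∈ Finset.range (n + 1), (m.choose k : ℝ)
        ≤ ∑ k ∈ Finset.range (n + 1), r ^ k * (m.choose k : ℝ) := by
          rw [Finset.mul_sum]
          refine Finset.sum_le_sum fun k hk => mul_le_mul_of_nonneg_right ?_ (by positivity)
          exact pow_le_pow_of_le_one hr0.le hr1 (by simpa [Nat.lt_succ_iff] using hk)
      _ ≤ ∑ k ∈ Finset.range (m + 1), r ^ k * (m.choose k : ℝ) :=
          Finset.sum_le_sum_of_subset_of_nonneg (Finset.range_subset_range.2 (by omega))
            fun _ _ _ => by positivity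
      _ = (r + 1) ^ m := by simp [add_pow]
      _ ≤ Real.exp r ^ m := by gcongr; exact Real.add_one_le_exp r
      _ = Real.exp 1 ^ n := by
          rw [← Real.exp_nat_mul, ← Real.exp_nat_mul, hr, mul_div_cancel₀ _ hm'.ne', mul_one]
  have e : (Real.exp 1 * m / n) ^ n = Real.exp 1 ^ n / r ^ n := by
    rw [← div_pow, hr]; congr 1; field_simp
  rw [e, le_div_iff₀ (by positivity), mul_comm]
  exact key

/-! ### Volume lower bound on the number of pieces -/

theorem volume_hyperplane {n : ℕ} {v : EuclideanSpace ℝ (Fin n)} (hv : v ≠ 0) (t : ℝ) :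
    volume {x | inner ℝ v x = t} = 0 := by
  by_cases hne : ∃ x₀, inner ℝ v x₀ = t
  · obtain ⟨x₀, hx₀⟩ := hne
    have h := Measure.addHaar_affineSubspace (volume : Measure (EuclideanSpace ℝ (Fin n)))
      (AffineSubspace.mk' x₀ (innerₛₗ ℝ v).ker) ?_
    · convert h using 2
      ext x
      simp [AffineSubspace.mem_mk', inner_sub_right, hx₀, sub_eq_zero]
    · intro htop
      have : v + x₀ ∈ AffineSubspace.mk' x₀ (innerₛₗ ℝ v).ker := by rw [htop]; trivial
      simp [AffineSubspace.mem_mk'] at this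
      exact hv this
  · push Not at hne
    simp [hne]

/-- If all parts of the ball cut out by the hyperplanes have diameter at most `ε`,
then there are at least `(2R/ε)ⁿ` of them. -/
theorem pow_le_card_signPatterns {n m : ℕ} {R ε : ℝ} (hε : 0 < ε) (hR : 0 ≤ R)
    {a : Fin m → EuclideanSpace ℝ (Fin n)} {τ : Fin m → ℝ} (ha : ∀ i, a i ≠ 0)
    (hdiam : ∀ P, ∀ x ∈ closedBall 0 R ∩ openRegion a τ P,
      ∀ y ∈ closedBall 0 R ∩ openRegion a τ P, ‖x - y‖ ≤ ε) :
    (2 * R / ε) ^ n ≤ (signPatterns a τ).card := by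
  set B : ℝ → Set (EuclideanSpace ℝ (Fin n)) := closedBall 0 with hB
  have cover : B R ⊆ (⋃ i, {x | inner ℝ (a i) x = τ i}) ∪
      ⋃ P ∈ signPatterns a τ, (B R ∩ openRegion a τ P) := by
    intro x hx
    by_cases h : ∃ i, inner ℝ (a i) x = τ i
    · exact Or.inl (Set.mem_iUnion.2 h)
    · push Not at h
      obtain ⟨P, hP⟩ := exists_mem_openRegion a τ h
      refine Or.inr (Set.mem_biUnion (x := P) ?_ ⟨hx, hP⟩)
      simpa [signPatterns] using ⟨x, hP⟩
  have h1 : volume (B R) ≤ (signPatterns a τ).card * volume (B (ε / 2)) := by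
    refine (measure_mono cover).trans ((measure_union_le _ _).trans ?_)
    rw [measure_iUnion_null fun i => volume_hyperplane (ha i) (τ i), zero_add, ← nsmul_eq_mul]
    refine (measure_biUnion_finset_le _ _).trans (Finset.sum_le_card_nsmul _ _ _ fun P _ => ?_)
    exact volume_le_volume_closedBall_of_dist_le
      (measurableSet_closedBall.inter (isOpen_openRegion a τ P).measurableSet) (hdiam P)
  rw [hB, Measure.addHaar_closedBall _ _ hR, Measure.addHaar_closedBall _ _ (by positivity),
    ← mul_assoc,
    ENNReal.mul_le_mul_iff_left (measure_ball_pos _ _ one_pos).ne' measure_ball_lt_top.ne,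
    finrank_euclideanSpace_fin, ← ENNReal.ofReal_natCast, ← ENNReal.ofReal_mul (by positivity),
    ENNReal.ofReal_le_ofReal_iff (by positivity)] at h1
  have e : 2 * R / ε = R / (ε / 2) := by field_simp
  rw [e, div_pow, div_le_iff₀ (by positivity)]
  exact h1

/-! ### Wide cells -/

/-- A convex part of the complement of the hyperplanes in the ball lies in one cell. -/
theorem exists_isCell_superset {n m : ℕ} {R : ℝ} {H : Fin m → Set (EuclideanSpace ℝ (Fin n))}
    {K : Set (EuclideanSpace ℝ (Fin n))} (hK : Convex ℝ K) (hK0 : K.Nonempty)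
    (hsub : K ⊆ ballComplement R H) : ∃ C, IsCell R H C ∧ K ⊆ C := by
  obtain ⟨x, hx⟩ := hK0
  exact ⟨_, ⟨x, hsub hx, rfl⟩, hK.isPreconnected.subset_connectedComponentIn hx hsub⟩

theorem exists_orthogonal_unit {n m : ℕ} (hmn : m < n) (a : Fin m → EuclideanSpace ℝ (Fin n)) :
    ∃ v : EuclideanSpace ℝ (Fin n), ‖v‖ = 1 ∧ ∀ i, inner ℝ (a i) v = 0 := by
  obtain ⟨w, hw, hw0⟩ := Submodule.exists_mem_ne_zero_of_ne_bot
    (LinearMap.ker_ne_bot_of_finrank_lt (f := LinearMap.pi fun i => innerₛₗ ℝ (a i)) (by simpa))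
  refine ⟨‖w‖⁻¹ • w, norm_smul_inv_norm hw0, fun i => ?_⟩
  have := congrFun (LinearMap.mem_ker.1 hw) i
  simp only [LinearMap.pi_apply, innerₛₗ_apply_apply, Pi.zero_apply] at this
  rw [inner_smul_right, this, mul_zero]

/-- With fewer hyperplanes than dimensions, some cell is almost as wide as the ball. -/
theorem exists_segment_of_lt {n m : ℕ} {R ε : ℝ} (hεR : ε < 2 * R) (hε : 0 < ε) (hmn : m < n)
    {a : Fin m → EuclideanSpace ℝ (Fin n)} {τ : Fin m → ℝ} (ha : ∀ i, a i ≠ 0) :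
    ∃ P, ∃ x ∈ closedBall 0 R ∩ openRegion a τ P,
      ∃ y ∈ closedBall 0 R ∩ openRegion a τ P, ε ≤ ‖x - y‖ := by
  obtain ⟨v, hv, hav⟩ := exists_orthogonal_unit hmn a
  -- The radius `R - ε/2` leaves room in `B_R` for a segment of half-length `ε/2` about `c`. Such a
  -- `c` exists because a null set cannot cover a ball.
  obtain ⟨c, hc, hcτ⟩ : ∃ c ∈ ball (0 : EuclideanSpace ℝ (Fin n)) (R - ε / 2),
      ∀ i, inner ℝ (a i) c ≠ τ i := by
    by_contra! hcon
    have hsub : ball (0 : EuclideanSpace ℝ (Fin n)) (R - ε / 2) ⊆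
        ⋃ i, {x | inner ℝ (a i) x = τ i} := fun c hc => Set.mem_iUnion.2 (hcon c hc)
    exact (measure_ball_pos volume _ (by linarith)).ne' (measure_mono_null hsub
      (measure_iUnion_null fun i => volume_hyperplane (ha i) (τ i)))
  obtain ⟨P, hP⟩ := exists_mem_openRegion a τ hcτ
  -- Moving along `v` changes no `⟪a i, ·⟫`, so the sign pattern persists.
  have mem : ∀ t : ℝ, |t| ≤ ε / 2 → c + t • v ∈ closedBall 0 R ∩ openRegion a τ P := by
    intro t ht
    refine ⟨?_, fun i => ?_⟩
    · rw [mem_closedBall_zero_iff]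
      rw [mem_ball_zero_iff] at hc
      have := norm_add_le c (t • v)
      rw [norm_smul, hv, Real.norm_eq_abs] at this
      linarith
    · rw [inner_add_right, inner_smul_right, hav, mul_zero, add_zero]
      exact hP i
  refine ⟨P, _, mem (ε / 2) (abs_of_pos (by linarith)).le, _,
    mem (-(ε / 2)) (by rw [abs_neg, abs_of_pos (by linarith)]), ?_⟩
  rw [add_sub_add_left_eq_sub, ← sub_smul, norm_smul, hv, sub_neg_eq_add, add_halves, mul_one]
  exact le_abs_self ε

theorem exists_wide_cell {n m : ℕ} {R ε : ℝ} (hε : 0 < ε) (hεR : ε < 2 * R)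
    {H : Fin m → Set (EuclideanSpace ℝ (Fin n))} (hH : ∀ i, IsAffineHyperplane (H i))
    (hm : (m : ℝ) < 2 / Real.exp 1 * (R / ε) * n) :
    ∃ C, IsCell R H C ∧ ∃ x ∈ C, ∃ y ∈ C, ε ≤ ‖x - y‖ := by
  choose a τ ha hHeq using hH
  suffices h : ∃ P, ∃ x ∈ closedBall 0 R ∩ openRegion a τ P,
      ∃ y ∈ closedBall 0 R ∩ openRegion a τ P, ε ≤ ‖x - y‖ by
    obtain ⟨P, x, hx, y, hy, hxy⟩ := h
    obtain ⟨C, hC, hsub⟩ := exists_isCell_superset (R := R) (H := H)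
      ((convex_closedBall 0 R).inter (convex_openRegion a τ P)) ⟨x, hx⟩ fun z hz =>
        ⟨hz.1, fun hz' => by
          obtain ⟨i, hi⟩ := Set.mem_iUnion.1 hz'
          rw [hHeq i] at hi
          exact inner_ne_of_mem_openRegion hz.2 i hi⟩
    exact ⟨C, hC, x, hsub hx, y, hsub hy, hxy⟩
  -- The estimate `(em/n)^n` requires `n ≤ m`, hence the separate argument for `m < n`.
  rcases lt_or_ge m n with hmn | hnm
  · exact exists_segment_of_lt hεR hε hmn ha
  by_contra! hcon
  rcases Nat.eq_zero_or_pos n with rfl | hn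
  · simp at hm
    linarith [(Nat.cast_nonneg m : (0 : ℝ) ≤ m)]
  have h1 := pow_le_card_signPatterns hε (by linarith : 0 ≤ R) ha
    fun P x hx y hy => (hcon P x hx y hy).le
  have h2 : ((signPatterns a τ).card : ℝ) ≤ ∑ k ∈ Finset.range (n + 1), (m.choose k : ℝ) := by
    exact_mod_cast card_signPatterns_le a τ
  have h3 := (h1.trans h2).trans (sum_choose_le_pow hn hnm)
  have h4 := le_of_pow_le_pow_left₀ hn.ne' (by positivity) h3
  have hn' : (0 : ℝ) < n := by exact_mod_cast hn
  have he := Real.exp_pos 1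
  rw [div_le_div_iff₀ hε hn'] at h4
  have e : 2 / Real.exp 1 * (R / ε) * n = 2 * R * n / (Real.exp 1 * ε) := by field_simp
  rw [e, lt_div_iff₀ (by positivity)] at hm
  linarith

/-! ### Paired comparisons -/

theorem comparison_eq_sign_inner {n : ℕ} (p q x : EuclideanSpace ℝ (Fin n)) :
    comparison p q x =
      SignType.sign (inner ℝ ((2 : ℝ) • (p - q)) x - (‖p‖ ^ 2 - ‖q‖ ^ 2)) := by
  unfold comparison
  congr 1
  rw [norm_sub_sq_real, norm_sub_sq_real, inner_smul_left, inner_sub_left,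
    real_inner_comm x q, real_inner_comm x p]
  simp
  ring

theorem sign_eq_of_isPreconnected {X : Type*} [TopologicalSpace X] {C : Set X}
    (hC : IsPreconnected C) {f : X → ℝ} (hf : Continuous f) (h0 : ∀ x ∈ C, f x ≠ 0) {x y : X}
    (hx : x ∈ C) (hy : y ∈ C) : SignType.sign (f x) = SignType.sign (f y) := by
  have key : ∀ x ∈ C, ∀ y ∈ C, f x < 0 → 0 < f y → False := by
    intro x hx y hy hfx hfy
    obtain ⟨z, hz, hz0⟩ := hC.intermediate_value hx hy hf.continuousOn ⟨hfx.le, hfy.le⟩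
    exact h0 z hz hz0
  rcases (h0 x hx).lt_or_gt with h | h <;> rcases (h0 y hy).lt_or_gt with h' | h'
  · rw [sign_neg h, sign_neg h']
  · exact (key x hx y hy h h').elim
  · exact (key y hy x hx h' h).elim
  · rw [sign_pos h, sign_pos h']

theorem le_of_uniformlyLocalizes {n m : ℕ} {R ε : ℝ} (hε : 0 < ε) (hεR : ε < 2 * R)
    {p q : Fin m → EuclideanSpace ℝ (Fin n)} (h : UniformlyLocalizes R ε p q) :
    2 / Real.exp 1 * (R / ε) * n ≤ (m : ℝ) := by
  by_contra! hlt
  have hn : 0 < n := by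
    rcases Nat.eq_zero_or_pos n with rfl | hn
    · simp at hlt
      linarith [(Nat.cast_nonneg m : (0 : ℝ) ≤ m)]
    · exact hn
  have cont : ContinuousAt (fun t : ℝ => 2 / Real.exp 1 * (R / t) * n) ε := by
    have := hε.ne'
    fun_prop (disch := assumption)
  -- Localization permits distance exactly `ε`, and a wide cell for `ε` guarantees no more. By
  -- continuity the strict bounds survive for some `δ > ε`, which gives a contradiction.
  obtain ⟨δ, hδ, hδm, hδR⟩ : ∃ δ, ε < δ ∧ (m : ℝ) < 2 / Real.exp 1 * (R / δ) * n ∧ δ < 2 * R := by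
    have h1 := (cont.eventually (lt_mem_nhds hlt)).filter_mono
      (nhdsWithin_le_nhds (s := Set.Ioi ε))
    have h2 := (gt_mem_nhds hεR).filter_mono (nhdsWithin_le_nhds (s := Set.Ioi ε))
    obtain ⟨δ, ⟨hd1, hd2⟩, hd3⟩ := ((h1.and h2).and self_mem_nhdsWithin).exists
    exact ⟨δ, hd3, hd1, hd2⟩
  obtain ⟨w, hw⟩ : ∃ w : EuclideanSpace ℝ (Fin n), w ≠ 0 :=
    ⟨EuclideanSpace.single ⟨0, hn⟩ 1, by simp⟩
  classical
  -- If `p i = q i` there is no bisector and the comparison is always `0`; the arbitrary normal `w`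
  -- merely supplies a harmless extra hyperplane.
  let a : Fin m → EuclideanSpace ℝ (Fin n) := fun i => if p i = q i then w else (2 : ℝ) • (p i - q i)
  let τ : Fin m → ℝ := fun i => ‖p i‖ ^ 2 - ‖q i‖ ^ 2
  let H : Fin m → Set (EuclideanSpace ℝ (Fin n)) := fun i => {x | inner ℝ (a i) x = τ i}
  have hH : ∀ i, IsAffineHyperplane (H i) := fun i => by
    refine ⟨a i, τ i, ?_, rfl⟩
    by_cases hpq : p i = q i
    · simpa [a, hpq] using hw
    · simp [a, hpq, sub_eq_zero]
  obtain ⟨C, ⟨z, hz, rfl⟩, x, hx, y, hy, hxy⟩ :=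
    exists_wide_cell (hε.trans hδ) hδR hH hδm
  have hsub := connectedComponentIn_subset (ballComplement R H) z
  refine absurd (h x (hsub hx).1 y (hsub hy).1 fun i => ?_) (not_le.2 (hδ.trans_le hxy))
  by_cases hpq : p i = q i
  · simp [comparison, hpq]
  · rw [comparison_eq_sign_inner, comparison_eq_sign_inner]
    refine sign_eq_of_isPreconnected isPreconnected_connectedComponentIn
      (f := fun x => inner ℝ ((2 : ℝ) • (p i - q i)) x - (‖p i‖ ^ 2 - ‖q i‖ ^ 2)) (by fun_prop)
      (fun u hu hu0 => (hsub hu).2 (Set.mem_iUnion.2 ⟨i, ?_⟩)) hx hy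
    simpa [H, a, τ, hpq] using sub_eq_zero.1 hu0

theorem mainTheorem3 (n m : ℕ) (R ε : ℝ) (hε : 0 < ε) (hεR : ε < 2 * R) :
    (∀ H : Fin m → Set (EuclideanSpace ℝ (Fin n)), (∀ i, IsAffineHyperplane (H i)) →
      (m : ℝ) < 2 / Real.exp 1 * (R / ε) * n →
        ∃ C, IsCell R H C ∧ ∃ x ∈ C, ∃ y ∈ C, ε ≤ ‖x - y‖) ∧
    (∀ p q : Fin m → EuclideanSpace ℝ (Fin n), UniformlyLocalizes R ε p q →
      2 / Real.exp 1 * (R / ε) * n ≤ (m : ℝ)) :=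
  ⟨fun _ hH hm => exists_wide_cell hε hεR hH hm, fun _ _ h => le_of_uniformlyLocalizes hε hεR h⟩
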